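/- Let $\sigma_1,\sigma_2,\sigma_3$ be the Pauli matrices, $\sigma_0=\mathbb 1$, and let $\gamma_1,\gamma_2,\gamma_3:[0,\infty)\to\mathbb R$ be locally integrable. Let $(\Lambda_t)_{t\ge 0}$ be the family of linear maps on $2\times 2$ complex matrices with $$\frac{\mathrm d}{\mathrm dt}\Lambda_t=\mathcal K^{\rm TCL}_t\Lambda_t,\qquad \Lambda_0=\mathbb 1,\qquad \mathcal K^{\rm TCL}_t(\omega)=\frac12\sum_{k=1}^3\gamma_k(t)\,(\sigma_k\omega\sigma_k-\omega).$$ For $\alpha=0,\dots,3$ let $m^{\rm TCL}_\alpha(t)$ be the eigenvalue of $\mathcal K^{\rm TCL}_t$ belonging to the eigenvector $\sigma_\alpha$, put $G_\alpha(t)=\frac{\mathrm d}{\mathrm dt}\exp\big(\int_0^t m^{\rm TCL}_\alpha(\tau)\,\mathrm d\tau\big)$, and assume that the Laplace transforms $\widetilde G_\alpha(u)=\int_0^\infty e^{-ut}G_\alpha(t)\,\mathrm dt$ converge absolutely and satisfy $|\widetilde G_\alpha(u)|<1$ for all $\alpha$ and all complex $u$ in some right half-plane $\{\operatorname{Re}u>a\}$.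 Let $\mathcal K^{\rm NZ}$ be the memory kernel of $\Lambda$, i.e. $\frac{\mathrm d}{\mathrm dt}\Lambda_t=\int_0^t\mathcal K^{\rm NZ}_{t-\tau}\Lambda_\tau\,\mathrm d\tau$. It may contain Dirac peaks; precisely, it is the distributional derivative of a locally integrable family $\mathcal K^{\rm Red}_t=\int_0^t\mathcal K^{\rm NZ}_\tau\,\mathrm d\tau$ with $\Lambda_t=\mathbb 1+\int_0^t\mathcal K^{\rm Red}_{t-\tau}\Lambda_\tau\,\mathrm d\tau$ for all $t\ge 0$. Let $(\Lambda^{\rm Red}_t)_{t\ge 0}$ be the associated Redfield-like dynamics, $\frac{\mathrm d}{\mathrm dt}\Lambda^{\rm Red}_t=\mathcal K^{\rm Red}_t\Lambda^{\rm Red}_t$, $\Lambda^{\rm Red}_0=\mathbb 1$. (Both time-local initial value problems are understood in integrated form.) Call a family $(\Phi_t)_{t\ge0}$ P-divisible if for all $0\le s\le t$ there is a positive trace-preserving linear map $V_{t,s}$ with $\Phi_t=V_{t,s}\Phi_s$. If $(\Lambda_t)_{t\ge0}$ is P-divisible, then $(\Lambda^{\rm Red}_t)_{t\ge0}$ is P-divisible.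 -/

import Mathlib

open MeasureTheory Set
open scoped ComplexOrder Matrix

namespace PauliDynamics

/-- The operators on the Hilbert space of a qubit. -/
abbrev Op : Type := Matrix (Fin 2) (Fin 2) ℂ

/-- Superoperators: linear maps acting on the operators of a qubit. -/
abbrev SuperOp : Type := Op →ₗ[ℂ] Op

/-- The identity together with the three Pauli matrices. -/
def pauli : Fin 4 → Op :=
  ![1, !![0, 1; 1, 0], !![0, -Complex.I; Complex.I, 0], !![1, 0; 0, -1]]

/-- The generator `ω ↦ (1/2) ∑ₖ γₖ(t) (σₖ ω σₖ - ω)`, where `k` runs over the three Pauli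
matrices. -/
noncomputable def pauliGenerator (γ : Fin 3 → ℝ → ℝ) (t : ℝ) : SuperOp :=
  (1 / 2 : ℂ) • ∑ k : Fin 3, (γ k t : ℂ) •
    (LinearMap.mulLeft ℂ (pauli k.succ) ∘ₗ LinearMap.mulRight ℂ (pauli k.succ) - LinearMap.id)

theorem pauliGenerator_apply (γ : Fin 3 → ℝ → ℝ) (t : ℝ) (ω : Op) :
    pauliGenerator γ t ω =
      (1 / 2 : ℂ) • ∑ k : Fin 3, (γ k t : ℂ) • (pauli k.succ * ω * pauli k.succ - ω) := by
  simp [pauliGenerator, LinearMap.sum_apply, mul_assoc]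

/-- `Tr[τ† Φ(τ)]` for the normalized element `τ = σ_α / √2` of the Pauli basis. If `Φ` is diagonal
in the Pauli basis, this is its eigenvalue belonging to `σ_α`. -/
noncomputable def eigenvalue (Φ : SuperOp) (α : Fin 4) : ℂ :=
  (1 / 2 : ℂ) * ((pauli α)ᴴ * Φ (pauli α)).trace

/-- The Pauli matrices are eigenvectors of the Pauli generator. -/
theorem pauliGenerator_pauli (γ : Fin 3 → ℝ → ℝ) (t : ℝ) (α : Fin 4) :
    pauliGenerator γ t (pauli α) = eigenvalue (pauliGenerator γ t) α • pauli α := by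
  rw [eigenvalue, pauliGenerator_apply]
  fin_cases α <;> ext i j <;> fin_cases i <;> fin_cases j <;>
    simp [pauli, Fin.sum_univ_three, Matrix.trace, Matrix.mul_apply, Matrix.conjTranspose_apply,
      Fin.sum_univ_two] <;> ring_nf <;> simp <;> ring

/-- A family of superoperators is locally integrable on `[0, ∞)` (in each matrix entry). -/
def LocInt (K : ℝ → SuperOp) : Prop :=
  ∀ (ω : Op) (i j : Fin 2) (t : ℝ), 0 ≤ t → IntervalIntegrable (fun s => K s ω i j) volume 0 t

/-- `Λ` is the evolution on `[0, ∞)` generated by the time-local generator `K`, i.e.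
`d/dt Λ_t = K_t Λ_t` and `Λ_0 = 1`. The generator is locally integrable, and the initial value
problem is understood in the sense of Carathéodory, i.e. in integrated form. -/
structure IsTimeLocalEvolution (K Λ : ℝ → SuperOp) : Prop where
  locInt : LocInt K
  continuousOn : ∀ (ω : Op) (i j : Fin 2), ContinuousOn (fun t => Λ t ω i j) (Ici 0)
  eq_integral : ∀ (ω : Op) (i j : Fin 2) (t : ℝ), 0 ≤ t →
    Λ t ω i j = ω i j + ∫ s in (0 : ℝ)..t, K s (Λ s ω) i j

/-- `K_t = ∫_0^t k_τ dτ` for the memory kernel `k` of the evolution `Λ`.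

In general `k` has a Dirac peak at time `0` (already if `Λ` is a semigroup), so that it is not a
function but the distributional derivative of the locally integrable function `K`. The equation
`d/dt Λ_t = ∫_0^t k_{t-τ} Λ_τ dτ = (k * Λ)_t` with `Λ_0 = 1` is therefore stated after one
integration in time, as `Λ_t = 1 + (K * Λ)_t`. See `IsRedfieldGenerator.of_kernel` for kernels
that are the sum of a Dirac peak and a function. -/
structure IsRedfieldGenerator (Λ K : ℝ → SuperOp) : Prop where
  locInt : LocInt K
  eq_convolution : ∀ (ω : Op) (i j : Fin 2) (t : ℝ), 0 ≤ t →
    Λ t ω i j = ω i j + ∫ s in (0 : ℝ)..t, K (t - s) (Λ s ω) i j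

/-- `1 * (a * b) = (1 * a) * b` for convolutions on `[0, ∞)`. -/
theorem convolution_primitive {a b : ℝ → ℂ} {t : ℝ} (ht : 0 ≤ t)
    (ha : IntervalIntegrable a volume 0 t) (hb : IntervalIntegrable b volume 0 t) :
    IntervalIntegrable (fun s => ∫ τ in (0 : ℝ)..s, a (s - τ) * b τ) volume 0 t ∧
    IntervalIntegrable (fun τ => (∫ r in (0 : ℝ)..(t - τ), a r) * b τ) volume 0 t ∧
    ∫ s in (0 : ℝ)..t, ∫ τ in (0 : ℝ)..s, a (s - τ) * b τ =
      ∫ τ in (0 : ℝ)..t, (∫ r in (0 : ℝ)..(t - τ), a r) * b τ := by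
  rw [intervalIntegrable_iff_integrableOn_Ioc_of_le ht] at ha hb
  set a' := indicator (Ioc 0 t) a with ha'
  set b' := indicator (Ioc 0 t) b with hb'
  have ia : Integrable a' := ha.integrable_indicator measurableSet_Ioc
  have ib : Integrable b' := hb.integrable_indicator measurableSet_Ioc
  have H : Integrable (fun p : ℝ × ℝ => a' (p.1 - p.2) * b' p.2)
      ((volume.restrict (Ioc 0 t)).prod volume) := by
    have := (Integrable.convolution_integrand (ContinuousLinearMap.mul ℂ ℂ) (μ := volume)
      (ν := volume) ib ia)
    simp only [ContinuousLinearMap.mul_apply'] at this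
    refine ((this.congr (ae_of_all _ fun p => mul_comm _ _)).mono_measure ?_)
    exact Measure.prod_mono Measure.restrict_le_self le_rfl
  have inner : ∀ s ∈ Ioc 0 t, ∫ τ, a' (s - τ) * b' τ = ∫ τ in (0 : ℝ)..s, a (s - τ) * b τ := by
    intro s hs
    rw [intervalIntegral.integral_of_le hs.1.le, integral_Ioc_eq_integral_Ioo,
      ← integral_indicator measurableSet_Ioo]
    congr 1
    ext τ
    by_cases h : τ ∈ Ioo 0 s
    · have h1 : s - τ ∈ Ioc 0 t := ⟨by linarith [h.2], by linarith [h.1, hs.2]⟩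
      have h2 : τ ∈ Ioc 0 t := ⟨h.1, by linarith [h.2, hs.2]⟩
      simp [ha', hb', h, h1, h2]
    · rw [indicator_of_notMem h]
      by_cases h2 : τ ∈ Ioc 0 t
      · have h1 : s - τ ∉ Ioc 0 t := fun h1 => h ⟨h2.1, by linarith [h1.1]⟩
        simp [ha', h1]
      · simp [hb', h2]
  have outer : ∀ τ, ∫ s in Ioc 0 t, a' (s - τ) * b' τ =
      indicator (Ioc 0 t) (fun τ => (∫ r in (0 : ℝ)..(t - τ), a r) * b τ) τ := by
    intro τ
    by_cases h2 : τ ∈ Ioc 0 t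
    · rw [indicator_of_mem h2, integral_mul_const]
      simp only [hb', indicator_of_mem h2]
      congr 1
      rw [← intervalIntegral.integral_of_le ht, intervalIntegral.integral_comp_sub_right a' τ,
        intervalIntegral.integral_of_le (by linarith [h2.1]),
        intervalIntegral.integral_of_le (by linarith [h2.2]), ha',
        setIntegral_indicator measurableSet_Ioc]
      congr 2
      ext x
      simp only [mem_inter_iff, mem_Ioc]
      constructor
      · rintro ⟨⟨_, h⟩, h', _⟩
        exact ⟨h', h⟩
      · rintro ⟨h, h'⟩
        exact ⟨⟨by linarith [h2.1], h'⟩, h, by linarith [h2.1]⟩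
    · simp [hb', h2]
  have I1 := H.integral_prod_left
  have I2 := H.integral_prod_right
  have S := integral_integral_swap (f := fun s τ => a' (s - τ) * b' τ) H
  simp only [outer] at I2 S
  refine ⟨?_, ?_, ?_⟩
  · rw [intervalIntegrable_iff_integrableOn_Ioc_of_le ht]
    exact IntegrableOn.congr_fun I1 inner measurableSet_Ioc
  · rw [intervalIntegrable_iff_integrableOn_Ioc_of_le ht]
    exact (integrable_indicator_iff measurableSet_Ioc).1 I2
  · rw [integral_indicator measurableSet_Ioc] at S
    rw [intervalIntegral.integral_of_le ht, intervalIntegral.integral_of_le ht, ← S]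
    exact (setIntegral_congr_fun measurableSet_Ioc inner).symm

theorem intervalIntegrable_sum {f : Fin 2 → ℝ → ℂ} {t : ℝ}
    (hf : ∀ p, IntervalIntegrable (f p) volume 0 t) :
    IntervalIntegrable (fun s => ∑ p : Fin 2, f p s) volume 0 t := by
  simp only [Fin.sum_univ_two]
  exact (hf 0).add (hf 1)

theorem superOp_apply_entry (Φ : SuperOp) (ω : Op) (i j : Fin 2) :
    Φ ω i j = ∑ p : Fin 2, ∑ q : Fin 2, Φ (Matrix.single p q 1) i j * ω p q := by
  conv_lhs => rw [Matrix.matrix_eq_sum_single ω]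
  simp only [map_sum, Matrix.sum_apply]
  refine Finset.sum_congr rfl fun p _ => Finset.sum_congr rfl fun q _ => ?_
  rw [← mul_one (ω p q), ← smul_eq_mul, ← Matrix.smul_single, map_smul]
  simp [mul_comm]

/-- If `Λ` solves `d/dt Λ_t = ∫_0^t 𝒦_{t-τ} Λ_τ dτ`, `Λ_0 = 1`, with the memory kernel
`𝒦_t = δ(t) A + k_t`, then its Redfield-like generator is
`∫_0^t 𝒦_τ dτ = A + ∫_0^t k_τ dτ`. -/
theorem IsRedfieldGenerator.of_kernel {Λ k K : ℝ → SuperOp} {A : SuperOp} (hk : LocInt k)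
    (hc : ∀ (ω : Op) (i j : Fin 2), ContinuousOn (fun t => Λ t ω i j) (Ici 0))
    (h0 : Λ 0 = LinearMap.id)
    (hd : ∀ (ω : Op) (i j : Fin 2) (t : ℝ), 0 < t → HasDerivAt (fun t => Λ t ω i j)
      (A (Λ t ω) i j + ∫ τ in (0 : ℝ)..t, k (t - τ) (Λ τ ω) i j) t)
    (hK : ∀ (ω : Op) (i j : Fin 2) (t : ℝ), 0 ≤ t →
      K t ω i j = A ω i j + ∫ τ in (0 : ℝ)..t, k τ ω i j) :
    IsRedfieldGenerator Λ K := by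
  have hΛi : ∀ (ω : Op) (i j : Fin 2) (t : ℝ), 0 ≤ t →
      IntervalIntegrable (fun s => Λ s ω i j) volume 0 t := fun ω i j t ht =>
    ((hc ω i j).mono fun x hx => by
      rw [uIcc_of_le ht] at hx; exact hx.1).intervalIntegrable
  constructor
  · intro ω i j t ht
    have h1 : ContinuousOn (fun s => A ω i j + ∫ τ in (0 : ℝ)..s, k τ ω i j) (uIcc 0 t) :=
      continuousOn_const.add
        (intervalIntegral.continuousOn_primitive_interval' (hk ω i j t ht) left_mem_uIcc)
    refine h1.intervalIntegrable.congr fun s hs => ?_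
    rw [uIoc_of_le ht] at hs
    exact (hK ω i j s hs.1.le).symm
  · intro ω i j t ht
    have key := fun p q : Fin 2 => convolution_primitive ht
      (hk (Matrix.single p q 1) i j t ht) (hΛi ω p q t ht)
    have iA : IntervalIntegrable (fun s => A (Λ s ω) i j) volume 0 t := by
      rw [show (fun s => A (Λ s ω) i j) = _ from funext fun s => superOp_apply_entry A _ i j]
      exact intervalIntegrable_sum fun p => intervalIntegrable_sum fun q =>
        (hΛi ω p q t ht).const_mul _
    have hconv : ∀ s ∈ uIcc 0 t, ∫ τ in (0 : ℝ)..s, k (s - τ) (Λ τ ω) i j =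
        ∑ p : Fin 2, ∑ q : Fin 2,
          ∫ τ in (0 : ℝ)..s, k (s - τ) (Matrix.single p q 1) i j * Λ τ ω p q := by
      intro s hs
      rw [uIcc_of_le ht] at hs
      have hi : ∀ p q : Fin 2, IntervalIntegrable
          (fun τ => k (s - τ) (Matrix.single p q 1) i j * Λ τ ω p q) volume 0 s := by
        intro p q
        have := (hk (Matrix.single p q 1) i j s hs.1).comp_sub_left s
        simp only [sub_zero, sub_self] at this
        exact this.symm.mul_continuousOn ((hc ω p q).mono fun x hx => by
          rw [uIcc_of_le hs.1] at hx; exact hx.1)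
      rw [show (fun τ => k (s - τ) (Λ τ ω) i j) = _ from
          funext fun τ => superOp_apply_entry (k (s - τ)) _ i j,
        intervalIntegral.integral_finsetSum fun p _ => intervalIntegrable_sum fun q => hi p q]
      exact Finset.sum_congr rfl fun p _ => intervalIntegral.integral_finsetSum fun q _ => hi p q
    have ik : IntervalIntegrable
        (fun s => ∫ τ in (0 : ℝ)..s, k (s - τ) (Λ τ ω) i j) volume 0 t := by
      refine (intervalIntegrable_sum fun p => intervalIntegrable_sum fun q =>
        (key p q).1).congr fun s hs => ?_
      exact (hconv s (uIoc_subset_uIcc hs)).symm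
    have F := intervalIntegral.integral_eq_sub_of_hasDerivAt_of_le ht
      ((hc ω i j).mono fun x hx => hx.1) (fun x hx => hd ω i j x hx.1) (iA.add ik)
    rw [h0, intervalIntegral.integral_add iA ik] at F
    have e : ∫ s in (0 : ℝ)..t, K (t - s) (Λ s ω) i j =
        (∫ s in (0 : ℝ)..t, A (Λ s ω) i j) +
          ∑ p : Fin 2, ∑ q : Fin 2, ∫ s in (0 : ℝ)..t,
            (∫ r in (0 : ℝ)..(t - s), k r (Matrix.single p q 1) i j) * Λ s ω p q := by
      have e1 : ∀ s ∈ uIcc 0 t, K (t - s) (Λ s ω) i j = A (Λ s ω) i j +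
          ∑ p : Fin 2, ∑ q : Fin 2,
            (∫ r in (0 : ℝ)..(t - s), k r (Matrix.single p q 1) i j) * Λ s ω p q := by
        intro s hs
        rw [uIcc_of_le ht] at hs
        rw [superOp_apply_entry (K _), superOp_apply_entry A]
        simp only [hK _ i j (t - s) (by linarith [hs.2]), add_mul, Finset.sum_add_distrib]
      have i2 : ∀ p : Fin 2, IntervalIntegrable (fun s => ∑ q : Fin 2,
          (∫ r in (0 : ℝ)..(t - s), k r (Matrix.single p q 1) i j) * Λ s ω p q) volume 0 t :=
        fun p => intervalIntegrable_sum fun q => (key p q).2.1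
      rw [intervalIntegral.integral_congr e1, intervalIntegral.integral_add iA
        (intervalIntegrable_sum fun p => i2 p),
        intervalIntegral.integral_finsetSum fun p _ => i2 p]
      congr 1
      exact Finset.sum_congr rfl fun p _ =>
        intervalIntegral.integral_finsetSum fun q _ => (key p q).2.1
    have e2 : ∫ s in (0 : ℝ)..t, ∫ τ in (0 : ℝ)..s, k (s - τ) (Λ τ ω) i j =
        ∑ p : Fin 2, ∑ q : Fin 2, ∫ s in (0 : ℝ)..t,
            (∫ r in (0 : ℝ)..(t - s), k r (Matrix.single p q 1) i j) * Λ s ω p q := by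
      rw [intervalIntegral.integral_congr hconv, intervalIntegral.integral_finsetSum
        fun p _ => intervalIntegrable_sum fun q => (key p q).1]
      refine Finset.sum_congr rfl fun p _ => ?_
      rw [intervalIntegral.integral_finsetSum fun q _ => (key p q).1]
      exact Finset.sum_congr rfl fun q _ => (key p q).2.2
    rw [e, ← e2, F]
    simp

/-- A linear map on operators is positive if it maps positive semidefinite operators to positive
semidefinite operators. -/
def IsPositiveMap (Φ : SuperOp) : Prop := ∀ ω : Op, ω.PosSemidef → (Φ ω).PosSemidef

/-- A linear map on operators is trace preserving. -/
def IsTracePreserving (Φ : SuperOp) : Prop := ∀ ω : Op, (Φ ω).trace = ω.trace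

/-- P-divisibility: for all `0 ≤ s ≤ t` there is a positive trace-preserving map `V_{t,s}` with
`Λ_t = V_{t,s} Λ_s`. -/
def PDivisible (Λ : ℝ → SuperOp) : Prop :=
  ∀ s t : ℝ, 0 ≤ s → s ≤ t →
    ∃ V : SuperOp, IsPositiveMap V ∧ IsTracePreserving V ∧ Λ t = V ∘ₗ Λ s

/-- `G_α(t) = d/dt exp (∫_0^t m_α(τ) dτ)`, where `m_α(t)` are the eigenvalues of the time-local
generator `K_t` in the Pauli basis. -/
noncomputable def gFun (K : ℝ → SuperOp) (α : Fin 4) : ℝ → ℂ :=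
  deriv fun t : ℝ => Complex.exp (∫ τ in (0 : ℝ)..t, eigenvalue (K τ) α)

/-- The integrand `e^{-ut} f(t)` of the Laplace transform. -/
noncomputable def laplaceIntegrand (f : ℝ → ℂ) (u : ℂ) (t : ℝ) : ℂ := Complex.exp (-u * t) * f t

/-- The Laplace transform `∫_0^∞ e^{-ut} f(t) dt`. -/
noncomputable def laplace (f : ℝ → ℂ) (u : ℂ) : ℂ := ∫ t in Ioi (0 : ℝ), laplaceIntegrand f u t

/-- `|G̃_α(u)| < 1` for every `α` (the Laplace transform being convergent), for all complex `u` in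
some right half-plane. -/
def LaplaceCondition (K : ℝ → SuperOp) : Prop :=
  ∃ a : ℝ, ∀ u : ℂ, a < u.re → ∀ α : Fin 4,
    IntegrableOn (laplaceIntegrand (gFun K α) u) (Ioi 0) ∧ ‖laplace (gFun K α) u‖ < 1

end PauliDynamics

/-!
Everything is diagonal in the Pauli basis, so the claim reduces to scalar statements about the
eigenvalues. The eigenvalues of `Λ_t` are `λ_α(t) = exp (∫_0^t m_α)` with `m_α` real and `m_0 = 0`
(`coeff_evolution`). In Bloch coordinates an operator is positive semidefinite if and only if its
coefficients lie in the forward light cone (`posSemidef_blochOp_iff`), and therefore dynamics of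
this form are P-divisible exactly if all exponents `∫_0^t m_α` are nonincreasing in `t`
(`pDivisible_iff_antitoneOn`).

In the Pauli basis, the equation `Λ = 1 + K * Λ` for the Redfield-like generator becomes the scalar
convolution equations `k * λ_α = δ_{αβ} (λ_α - 1)` for the matrix elements
`k = Tr[σ_βᴴ K_t(σ_α)] / 2`. If `Λ` is P-divisible, then `λ_α = 1 - ∫ g` with `g = -λ_α' ≥ 0`. An
integration turns the equation for the diagonal elements into the Volterra equation
`-k = g + g * (-k)` of the second kind. Its kernel is nonnegative, whence `-k ≥ 0`: this is the sum
`g + g * g + g * g * g + ⋯`, and is derived here from a Gronwall type argument for the positive part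
(`ae_nonpos_of_le_convolution`), applied to the real part of `k` and to both signs of its imaginary
part. The same argument with both signs shows that the elements off the diagonal vanish, and so
does the element for `α = β = 0`, where `λ_0 = 1`. Hence `K_t` is, for almost every `t`, diagonal
with real nonpositive eigenvalues (`isPauliDiagonal_redfield`), and the criterion for P-divisibility
applies to the dynamics it generates.
-/

namespace PauliDynamics

/-! ### Volterra inequalities and linear differential equations -/

/-- By the Lebesgue differentiation theorem, `g` is almost everywhere the derivative of its
primitive. -/
theorem ae_nonneg_of_monotoneOn_primitive {g : ℝ → ℝ}
    (hg : ∀ t, 0 ≤ t → IntervalIntegrable g volume 0 t)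
    (hmono : MonotoneOn (fun t => ∫ s in (0 : ℝ)..t, g s) (Ici 0)) :
    ∀ᵐ t, 0 < t → 0 ≤ g t := by
  have key : ∀ n : ℕ, ∀ᵐ t : ℝ, 0 < t → t < n → 0 ≤ g t := by
    intro n
    filter_upwards [(hg n n.cast_nonneg).ae_hasDerivAt_integral] with t ht h0 hn
    have hd := ht (by rw [uIcc_of_le (Nat.cast_nonneg n)]; exact ⟨h0.le, hn.le⟩) 0 left_mem_uIcc
    have := hmono.derivWithin_nonneg (x := t)
    rwa [(hd.hasDerivWithinAt).derivWithin (uniqueDiffOn_Ici 0 t h0.le)] at this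
  filter_upwards [ae_all_iff.2 key] with t ht h0
  obtain ⟨n, hn⟩ := exists_nat_gt t
  exact ht n h0 hn

theorem ae_restrict_Ioc_of_ae_pos {p : ℝ → Prop} (h : ∀ᵐ t, 0 < t → p t) {a : ℝ} (ha : 0 ≤ a)
    (b : ℝ) : ∀ᵐ t ∂volume.restrict (Ioc a b), p t := by
  rw [ae_restrict_iff' measurableSet_Ioc]
  filter_upwards [h] with t ht h1
  exact ht (ha.trans_lt h1.1)

theorem integral_mono_of_ae_pos {f g : ℝ → ℝ} {t : ℝ} (ht : 0 ≤ t)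
    (hf : IntervalIntegrable f volume 0 t) (hg : IntervalIntegrable g volume 0 t)
    (h : ∀ᵐ s, 0 < s → s ≤ t → f s ≤ g s) :
    ∫ s in (0 : ℝ)..t, f s ≤ ∫ s in (0 : ℝ)..t, g s := by
  refine intervalIntegral.integral_mono_ae_restrict ht hf hg ?_
  rw [Filter.EventuallyLE, ae_restrict_iff' measurableSet_Icc]
  filter_upwards [h, Measure.ae_ne volume (0 : ℝ)] with s hs h0 h1
  exact hs (lt_of_le_of_ne h1.1 h0.symm) h1.2

/-- `convolution_primitive` for real functions. -/
theorem convolution_primitive_real {a b : ℝ → ℝ} {t : ℝ} (ht : 0 ≤ t)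
    (ha : IntervalIntegrable a volume 0 t) (hb : IntervalIntegrable b volume 0 t) :
    IntervalIntegrable (fun s => ∫ τ in (0 : ℝ)..s, a (s - τ) * b τ) volume 0 t ∧
    IntervalIntegrable (fun τ => (∫ r in (0 : ℝ)..(t - τ), a r) * b τ) volume 0 t ∧
    ∫ s in (0 : ℝ)..t, ∫ τ in (0 : ℝ)..s, a (s - τ) * b τ =
      ∫ τ in (0 : ℝ)..t, (∫ r in (0 : ℝ)..(t - τ), a r) * b τ := by
  have H := convolution_primitive ht (a := fun s => (a s : ℂ)) (b := fun s => (b s : ℂ))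
    ⟨ha.1.ofReal, ha.2.ofReal⟩ ⟨hb.1.ofReal, hb.2.ofReal⟩
  simp only [← Complex.ofReal_mul, intervalIntegral.integral_ofReal] at H
  refine ⟨?_, ?_, by exact_mod_cast H.2.2⟩
  · exact ⟨(by simpa using H.1.1.re : Integrable _ _), (by simpa using H.1.2.re : Integrable _ _)⟩
  · exact ⟨(by simpa using H.2.1.1.re : Integrable _ _),
      (by simpa using H.2.1.2.re : Integrable _ _)⟩

/-- No integrability is needed here: if `u` is not integrable, then the left-hand side is `0`. -/
theorem integral_le_integral_max_zero (u : ℝ → ℝ) (μ : Measure ℝ) :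
    ∫ x, u x ∂μ ≤ ∫ x, max (u x) 0 ∂μ := by
  by_cases hu : Integrable u μ
  · exact integral_mono hu hu.pos_part fun x => le_max_left _ _
  · rw [integral_undef hu]
    exact integral_nonneg fun x => le_max_right _ _

theorem monotoneOn_primitive_of_ae_nonneg {g : ℝ → ℝ}
    (hg : ∀ t, 0 ≤ t → IntervalIntegrable g volume 0 t) (g0 : ∀ᵐ t, 0 < t → 0 ≤ g t) :
    MonotoneOn (fun t => ∫ s in (0 : ℝ)..t, g s) (Ici 0) := by
  intro s hs t ht hst
  have n : 0 ≤ ∫ r in s..t, g r := by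
    rw [intervalIntegral.integral_of_le hst]
    exact integral_nonneg_of_ae (ae_restrict_Ioc_of_ae_pos g0 hs t)
  have := intervalIntegral.integral_add_adjacent_intervals (hg s hs)
    ((hg s hs).symm.trans (hg t ht))
  simp only
  linarith

theorem exists_pos_primitive_le_half {g : ℝ → ℝ} (hg : IntervalIntegrable g volume 0 1) :
    ∃ δ, 0 < δ ∧ ∫ s in (0 : ℝ)..δ, g s ≤ 1 / 2 := by
  have c : ContinuousOn (fun t => ∫ s in (0 : ℝ)..t, g s) (uIcc 0 1) :=
    intervalIntegral.continuousOn_primitive_interval' hg left_mem_uIcc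
  rw [uIcc_of_le zero_le_one] at c
  have c0 : Filter.Tendsto (fun t => ∫ s in (0 : ℝ)..t, g s) (nhdsWithin 0 (Ioi 0)) (nhds 0) := by
    have h := (c 0 ⟨le_rfl, zero_le_one⟩).tendsto
    rw [intervalIntegral.integral_same] at h
    rw [← nhdsWithin_Ioc_eq_nhdsGT (zero_lt_one (α := ℝ))]
    exact h.mono_left (nhdsWithin_mono 0 Ioc_subset_Icc_self)
  obtain ⟨δ, h1, h2⟩ :=
    ((c0.eventually_lt_const one_half_pos).and self_mem_nhdsWithin).exists
  exact ⟨δ, h2, h1.le⟩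

/-- If the integral of `p` over `[0, a]` vanishes, the Volterra inequality carries this over to
`[0, a + δ]`, for a step `δ` on which the kernel has mass at most `1 / 2`. -/
theorem integral_eq_zero_add_of_le {p Γ : ℝ → ℝ} {a δ : ℝ} (a0 : 0 ≤ a) (δ0 : 0 ≤ δ)
    (ip : ∀ t, 0 ≤ t → IntervalIntegrable p volume 0 t) (p0 : ∀ t, 0 ≤ p t)
    (Γmono : MonotoneOn Γ (Ici 0)) (hδ : Γ δ ≤ 1 / 2)
    (iΓ : IntervalIntegrable (fun τ => Γ (a + δ - τ) * p τ) volume 0 (a + δ))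
    (hle : ∫ s in (0 : ℝ)..(a + δ), p s ≤ ∫ τ in (0 : ℝ)..(a + δ), Γ (a + δ - τ) * p τ)
    (h0 : ∫ s in (0 : ℝ)..a, p s = 0) : ∫ s in (0 : ℝ)..(a + δ), p s = 0 := by
  have t0 : 0 ≤ a + δ := by positivity
  have ip2 : IntervalIntegrable p volume a (a + δ) := (ip a a0).symm.trans (ip _ t0)
  have iΓ1 : IntervalIntegrable (fun τ => Γ (a + δ - τ) * p τ) volume 0 a := iΓ.mono_set (by
    rw [uIcc_of_le t0, uIcc_of_le a0]; exact Icc_subset_Icc_right (by linarith))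
  have iΓ2 : IntervalIntegrable (fun τ => Γ (a + δ - τ) * p τ) volume a (a + δ) :=
    iΓ.mono_set (by
      rw [uIcc_of_le t0, uIcc_of_le (by linarith)]; exact Icc_subset_Icc_left a0)
  rw [← intervalIntegral.integral_add_adjacent_intervals iΓ1 iΓ2] at hle
  rw [← intervalIntegral.integral_add_adjacent_intervals (ip a a0) ip2, h0] at hle ⊢
  have b1 : ∫ τ in (0 : ℝ)..a, Γ (a + δ - τ) * p τ ≤ ∫ τ in (0 : ℝ)..a, Γ (a + δ) * p τ := by
    refine intervalIntegral.integral_mono_on a0 iΓ1 ((ip a a0).const_mul _) fun τ hτ => ?_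
    exact mul_le_mul_of_nonneg_right (Γmono (by simp only [mem_Ici]; linarith [hτ.2]) t0
      (by linarith [hτ.1])) (p0 τ)
  have b2 : ∫ τ in a..(a + δ), Γ (a + δ - τ) * p τ ≤ ∫ τ in a..(a + δ), 1 / 2 * p τ := by
    refine intervalIntegral.integral_mono_on (by linarith) iΓ2 (ip2.const_mul _) fun τ hτ => ?_
    refine mul_le_mul_of_nonneg_right ((Γmono ?_ δ0 (by linarith [hτ.1])).trans hδ) (p0 τ)
    simp only [mem_Ici]
    linarith [hτ.2]
  rw [intervalIntegral.integral_const_mul] at b1 b2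
  rw [h0] at b1
  have b3 : 0 ≤ ∫ τ in a..(a + δ), p τ :=
    intervalIntegral.integral_nonneg (by linarith) fun τ _ => p0 τ
  linarith

/-- A linear Volterra inequality of the second kind with a nonnegative kernel has no solution
with a nontrivial positive part: the positive part `p` of `h` satisfies `p ≤ g * p`, and the mass
of the kernel on a short interval `[0, δ]` is at most `1 / 2`, so that `p` vanishes on `[0, n δ]`
for every `n`. -/
theorem ae_nonpos_of_le_convolution {g h : ℝ → ℝ}
    (hg : ∀ t, 0 ≤ t → IntervalIntegrable g volume 0 t)
    (hh : ∀ t, 0 ≤ t → IntervalIntegrable h volume 0 t)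
    (g0 : ∀ᵐ t, 0 < t → 0 ≤ g t)
    (hle : ∀ᵐ t, 0 < t → h t ≤ ∫ τ in (0 : ℝ)..t, g (t - τ) * h τ) :
    ∀ᵐ t, 0 < t → h t ≤ 0 := by
  obtain ⟨p, hp⟩ : ∃ p : ℝ → ℝ, p = fun t => max (h t) 0 := ⟨_, rfl⟩
  have p0 : ∀ t, 0 ≤ p t := fun t => by rw [hp]; exact le_max_right _ _
  have ip : ∀ t, 0 ≤ t → IntervalIntegrable p volume 0 t := fun t ht => by
    rw [hp]; exact ⟨(hh t ht).1.pos_part, (hh t ht).2.pos_part⟩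
  have ple : ∀ᵐ t, 0 < t → p t ≤ ∫ τ in (0 : ℝ)..t, g (t - τ) * p τ := by
    filter_upwards [hle] with t ht t0
    have g0' : ∀ᵐ τ, τ ∈ Ioc 0 t → 0 ≤ g (t - τ) := by
      have := (Measure.measurePreserving_sub_left volume t).quasiMeasurePreserving.ae g0
      filter_upwards [this, Measure.ae_ne volume t] with τ h1 h2 h3
      exact h1 (sub_pos.2 (lt_of_le_of_ne h3.2 h2))
    rw [intervalIntegral.integral_of_le t0.le] at ht ⊢
    have e : ∫ τ in Ioc 0 t, g (t - τ) * p τ = ∫ τ in Ioc 0 t, max (g (t - τ) * h τ) 0 := by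
      refine setIntegral_congr_ae measurableSet_Ioc ?_
      filter_upwards [g0'] with τ h1 h2
      rw [hp, mul_max_of_nonneg _ _ (h1 h2), mul_zero]
    rw [e, hp]
    exact max_le ((ht t0).trans (integral_le_integral_max_zero _ _))
      (integral_nonneg fun _ => le_max_right _ _)
  have key := fun t (ht : 0 ≤ t) => convolution_primitive_real ht (hg t ht) (ip t ht)
  have step : ∀ t, 0 ≤ t → ∫ s in (0 : ℝ)..t, p s ≤
      ∫ τ in (0 : ℝ)..t, (∫ r in (0 : ℝ)..(t - τ), g r) * p τ := by
    intro t ht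
    rw [← (key t ht).2.2]
    refine integral_mono_of_ae_pos ht (ip t ht) (key t ht).1 ?_
    filter_upwards [ple] with s hs h0 _ using hs h0
  obtain ⟨δ, δ0, hδ⟩ := exists_pos_primitive_le_half (hg 1 zero_le_one)
  have vanish : ∀ n : ℕ, ∫ s in (0 : ℝ)..(n * δ), p s = 0 := by
    intro n
    induction n with
    | zero => simp
    | succ n ih =>
      have a0 : 0 ≤ (n : ℝ) * δ := by positivity
      have t0 : 0 ≤ (n : ℝ) * δ + δ := by positivity
      rw [Nat.cast_succ, add_one_mul]
      exact integral_eq_zero_add_of_le a0 δ0.le ip p0 (monotoneOn_primitive_of_ae_nonneg hg g0) hδ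
        (key _ t0).2.1 (step _ t0) ih
  have zero : ∀ t, 0 ≤ t → ∫ s in (0 : ℝ)..t, p s = 0 := by
    intro t ht
    obtain ⟨n, hn⟩ := exists_nat_ge (t / δ)
    rw [div_le_iff₀ δ0] at hn
    refine le_antisymm ?_ (intervalIntegral.integral_nonneg ht fun τ _ => p0 τ)
    exact (intervalIntegral.integral_mono_interval le_rfl ht hn
      (Filter.Eventually.of_forall p0) (ip _ (ht.trans hn))).trans_eq (vanish n)
  have := ae_nonneg_of_monotoneOn_primitive (g := fun s => - p s) (fun t ht => (ip t ht).neg) (by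
    intro s hs t ht _
    simp only [intervalIntegral.integral_neg]
    rw [zero s hs, zero t ht])
  filter_upwards [this] with t ht h0
  have h1 := ht h0
  rw [hp] at h1
  linarith [le_max_left (h t) 0]

/-- The convolution equation `h * lam = c (lam - 1)` of the first kind with
`lam = 1 - ∫ g`: after an integration by parts, `∫ (g * h - h) = c ∫ g` is increasing, so that
`h ≤ g * h`. -/
theorem ae_nonpos_of_convolution_eq {g h lam : ℝ → ℝ} {c : ℝ} (hc : 0 ≤ c)
    (hg : ∀ t, 0 ≤ t → IntervalIntegrable g volume 0 t)
    (hh : ∀ t, 0 ≤ t → IntervalIntegrable h volume 0 t)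
    (g0 : ∀ᵐ t, 0 < t → 0 ≤ g t)
    (hlam : ∀ t, 0 ≤ t → lam t = 1 - ∫ s in (0 : ℝ)..t, g s)
    (heq : ∀ t, 0 ≤ t → ∫ s in (0 : ℝ)..t, h (t - s) * lam s = c * (lam t - 1)) :
    ∀ᵐ t, 0 < t → h t ≤ 0 := by
  refine ae_nonpos_of_le_convolution hg hh g0 ?_
  have key := fun t (ht : 0 ≤ t) => convolution_primitive_real ht (hg t ht) (hh t ht)
  have prim : ∀ t, 0 ≤ t → ∫ s in (0 : ℝ)..t, ((∫ τ in (0 : ℝ)..s, g (s - τ) * h τ) - h s) =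
      c * ∫ s in (0 : ℝ)..t, g s := by
    intro t ht
    obtain ⟨h1, h2, h3⟩ := key t ht
    rw [intervalIntegral.integral_sub h1 (hh t ht), h3,
      ← intervalIntegral.integral_sub h2 (hh t ht)]
    have e := heq t ht
    have e1 : ∫ s in (0 : ℝ)..t, h (t - s) * lam s = ∫ s in (0 : ℝ)..t, h s * lam (t - s) := by
      simpa using intervalIntegral.integral_comp_sub_left (a := 0) (b := t)
        (fun s => h s * lam (t - s)) t
    rw [hlam t ht, e1] at e
    have e2 : ∫ s in (0 : ℝ)..t, h s * lam (t - s) =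
        - ∫ s in (0 : ℝ)..t, ((∫ r in (0 : ℝ)..(t - s), g r) * h s - h s) := by
      rw [← intervalIntegral.integral_neg]
      refine intervalIntegral.integral_congr fun s hs => ?_
      rw [uIcc_of_le ht] at hs
      simp only [hlam (t - s) (by linarith [hs.2])]
      ring
    linarith
  have := ae_nonneg_of_monotoneOn_primitive
    (g := fun s => (∫ τ in (0 : ℝ)..s, g (s - τ) * h τ) - h s)
    (fun t ht => (key t ht).1.sub (hh t ht)) (by
      intro s hs t ht hst
      simp only
      rw [prim s hs, prim t ht]
      exact mul_le_mul_of_nonneg_left (monotoneOn_primitive_of_ae_nonneg hg g0 hs ht hst) hc)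
  filter_upwards [this] with t ht h0
  linarith [ht h0]

theorem absolutelyContinuousOnInterval_exp {f : ℝ → ℝ} {a b : ℝ}
    (hf : AbsolutelyContinuousOnInterval f a b) :
    AbsolutelyContinuousOnInterval (fun t => Real.exp (f t)) a b := by
  obtain ⟨C, hC⟩ := hf.exists_bound
  have hf' := hf
  unfold AbsolutelyContinuousOnInterval at hf' ⊢
  refine squeeze_zero' (Filter.Eventually.of_forall fun _ =>
    Finset.sum_nonneg fun i hi => dist_nonneg) ?_ (by simpa using hf'.const_mul (Real.exp C))
  rw [Filter.eventually_inf_principal]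
  filter_upwards with (n, I) hnI
  rw [Finset.mul_sum]
  refine Finset.sum_le_sum fun i hi => ?_
  obtain ⟨h1, h2⟩ := hnI.1 i hi
  have := (convex_Icc (-C) C).norm_image_sub_le_of_norm_hasDerivWithin_le (f := Real.exp)
    (f' := Real.exp) (C := Real.exp C) (fun x _ => (Real.hasDerivAt_exp x).hasDerivWithinAt)
    (fun x hx => by simpa using hx.2) (abs_le.1 (hC _ h2)) (abs_le.1 (hC _ h1))
  simpa [dist_eq_norm] using this

/-- The linear initial value problem `y' = k y` in the sense of Carathéodory is solved by
`exp (∫ k)` only. -/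
theorem eq_mul_exp_of_eq_integral {k y : ℝ → ℝ} {y0 T : ℝ} (hT : 0 ≤ T)
    (hk : IntervalIntegrable k volume 0 T) (hy : ContinuousOn y (Icc 0 T))
    (heq : ∀ t ∈ Icc 0 T, y t = y0 + ∫ s in (0 : ℝ)..t, k s * y s) :
    y T = y0 * Real.exp (∫ s in (0 : ℝ)..T, k s) := by
  have iky : IntervalIntegrable (fun s => k s * y s) volume 0 T :=
    hk.mul_continuousOn (by rwa [uIcc_of_le hT])
  have acK := (hk.absolutelyContinuousOnInterval_intervalIntegral (c := 0) left_mem_uIcc)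
  have acY := iky.absolutelyContinuousOnInterval_intervalIntegral (c := 0) left_mem_uIcc
  -- The product of the solution with `exp (-∫ k)` has derivative `0` almost everywhere.
  have acE := absolutelyContinuousOnInterval_exp acK.fun_neg
  have acC : AbsolutelyContinuousOnInterval (fun _ : ℝ => y0) 0 T :=
    contDiff_const.contDiffOn.absolutelyContinuousOnInterval
  have acZ := acE.fun_mul (acC.fun_add acY)
  obtain ⟨C, hC⟩ := acZ.const_of_ae_hasDerivAt_zero (by
    filter_upwards [hk.ae_hasDerivAt_integral, iky.ae_hasDerivAt_integral] with t h1 h2 ht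
    have d1 := (h1 ht 0 left_mem_uIcc).neg.exp
    have d2 := (h2 ht 0 left_mem_uIcc).const_add y0
    refine (d1.mul d2).congr_deriv ?_
    rw [uIcc_of_le hT] at ht
    rw [heq t ht]
    simp only [Pi.neg_apply]
    ring)
  have c0 := hC 0 left_mem_uIcc
  have cT := hC T right_mem_uIcc
  simp only [intervalIntegral.integral_same, neg_zero, Real.exp_zero, add_zero, one_mul] at c0
  rw [← c0, ← heq T ⟨hT, le_rfl⟩, Real.exp_neg] at cT
  field_simp at cT
  linarith

/-- `eq_mul_exp_of_eq_integral` for complex solutions, with real coefficients. -/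
theorem eq_mul_exp_of_eq_integral_complex {k : ℝ → ℝ} {y : ℝ → ℂ} {y0 : ℂ} {T : ℝ} (hT : 0 ≤ T)
    (hk : IntervalIntegrable k volume 0 T) (hy : ContinuousOn y (Icc 0 T))
    (heq : ∀ t ∈ Icc 0 T, y t = y0 + ∫ s in (0 : ℝ)..t, (k s : ℂ) * y s) :
    y T = y0 * (Real.exp (∫ s in (0 : ℝ)..T, k s) : ℂ) := by
  have ii : ∀ t ∈ Icc 0 T, IntervalIntegrable (fun s => (k s : ℂ) * y s) volume 0 t := by
    intro t ht
    have hk' := hk.mono_set (c := 0) (d := t)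
      (by rw [uIcc_of_le hT, uIcc_of_le ht.1]; exact Icc_subset_Icc_right ht.2)
    refine IntervalIntegrable.mul_continuousOn ⟨hk'.1.ofReal, hk'.2.ofReal⟩ (hy.mono ?_)
    rw [uIcc_of_le ht.1]
    exact Icc_subset_Icc_right ht.2
  apply Complex.ext
  · rw [Complex.re_mul_ofReal]
    refine eq_mul_exp_of_eq_integral hT hk (Complex.continuous_re.comp_continuousOn hy)
      fun t ht => ?_
    have := Complex.reCLM.intervalIntegral_comp_comm (ii t ht)
    simp only [Complex.reCLM_apply, Complex.re_ofReal_mul] at this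
    simp only [Function.comp, this]
    rw [heq t ht, Complex.add_re]
  · rw [Complex.im_mul_ofReal]
    refine eq_mul_exp_of_eq_integral hT hk (Complex.continuous_im.comp_continuousOn hy)
      fun t ht => ?_
    have := Complex.imCLM.intervalIntegral_comp_comm (ii t ht)
    simp only [Complex.imCLM_apply, Complex.im_ofReal_mul] at this
    simp only [Function.comp, this]
    rw [heq t ht, Complex.add_im]

/-! ### The Pauli basis -/

/-- The coefficient `Tr[σ_αᴴ ω] / 2` of `σ_α` in the expansion of `ω` in the Pauli basis. -/
noncomputable def coeff (α : Fin 4) : Op →ₗ[ℂ] ℂ :=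
  (1 / 2 : ℂ) • (Matrix.traceLinearMap (Fin 2) ℂ ℂ ∘ₗ LinearMap.mulLeft ℂ (pauli α)ᴴ)

theorem eigenvalue_eq_coeff (Φ : SuperOp) (α : Fin 4) :
    eigenvalue Φ α = coeff α (Φ (pauli α)) := rfl

theorem coeff_eq_sum (α : Fin 4) (ω : Op) :
    coeff α ω = ∑ i, ∑ j, (1 / 2 * star (pauli α i j)) * ω i j := by
  simp only [coeff, LinearMap.smul_apply, LinearMap.comp_apply, Matrix.traceLinearMap_apply,
    LinearMap.mulLeft_apply, Matrix.trace, Matrix.diag, Matrix.mul_apply,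
    Matrix.conjTranspose_apply, Fin.sum_univ_two, smul_eq_mul]
  ring

theorem coeff_pauli (α β : Fin 4) : coeff β (pauli α) = if β = α then 1 else 0 := by
  rw [coeff_eq_sum]
  fin_cases α <;> fin_cases β <;> simp [pauli, Fin.sum_univ_two] <;> norm_num [mul_assoc]

theorem sum_coeff_smul_pauli (ω : Op) : ∑ α, coeff α ω • pauli α = ω := by
  simp only [coeff_eq_sum, Fin.sum_univ_two, Fin.sum_univ_four]
  ext i j
  fin_cases i <;> fin_cases j <;> simp [pauli] <;> ring_nf <;> simp <;> ring_nf

theorem op_ext {ω ω' : Op} (h : ∀ α, coeff α ω = coeff α ω') : ω = ω' := by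
  rw [← sum_coeff_smul_pauli ω, ← sum_coeff_smul_pauli ω']
  simp only [h]

theorem trace_eq_coeff (ω : Op) : ω.trace = 2 * coeff 0 ω := by
  simp [coeff, pauli]

/-- A superoperator that is diagonal in the Pauli basis acts on the coefficients. -/
theorem coeff_apply_of_diagonal {Φ : SuperOp} {μ : Fin 4 → ℂ}
    (h : ∀ α β, coeff β (Φ (pauli α)) = if β = α then μ β else 0) (β : Fin 4) (ω : Op) :
    coeff β (Φ ω) = μ β * coeff β ω := by
  conv_lhs => rw [← sum_coeff_smul_pauli ω]
  simp [h, mul_comm]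

/-- The operator with real coefficients `x` in the Pauli basis. -/
noncomputable def blochOp (x : Fin 4 → ℝ) : Op := ∑ α, (x α : ℂ) • pauli α

theorem blochOp_eq (x : Fin 4 → ℝ) : blochOp x =
    !![(x 0 + x 3 : ℂ), x 1 - x 2 * Complex.I; x 1 + x 2 * Complex.I, x 0 - x 3] := by
  ext i j
  fin_cases i <;> fin_cases j <;> simp [blochOp, pauli, Fin.sum_univ_four] <;> ring

theorem isHermitian_blochOp (x : Fin 4 → ℝ) : (blochOp x).IsHermitian := by
  rw [blochOp_eq]
  ext i j
  fin_cases i <;> fin_cases j <;> simp [sub_eq_add_neg]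

theorem eq_blochOp_of_isHermitian {ω : Op} (h : ω.IsHermitian) :
    ω = blochOp fun α => (coeff α ω).re := by
  have hc : ∀ α, ((coeff α ω).re : ℂ) = coeff α ω := by
    intro α
    rw [← Complex.conj_eq_iff_re]
    have h00 := h.apply 0 0
    have h01 := h.apply 0 1
    have h10 := h.apply 1 0
    have h11 := h.apply 1 1
    simp only [Complex.star_def] at h00 h01 h10 h11
    rw [coeff_eq_sum]
    fin_cases α <;> simp [pauli, Fin.sum_univ_two, h00, h01, h10, h11, map_ofNat] <;> ring
  simp only [blochOp, hc]
  exact (sum_coeff_smul_pauli ω).symm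

/-- An operator is positive semidefinite if and only if its Pauli coefficients lie in the forward
light cone. -/
theorem posSemidef_blochOp_iff (x : Fin 4 → ℝ) :
    (blochOp x).PosSemidef ↔ 0 ≤ x 0 ∧ x 1 ^ 2 + x 2 ^ 2 + x 3 ^ 2 ≤ x 0 ^ 2 := by
  constructor
  · intro h
    have h0 := h.diag_nonneg (i := 0)
    have h1 := h.diag_nonneg (i := 1)
    have hd := h.det_nonneg
    rw [blochOp_eq] at h0 h1 hd
    have e : (!![(x 0 + x 3 : ℂ), x 1 - x 2 * Complex.I; x 1 + x 2 * Complex.I, x 0 - x 3]).det =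
        ((x 0 ^ 2 - (x 1 ^ 2 + x 2 ^ 2 + x 3 ^ 2) : ℝ) : ℂ) := by
      rw [Matrix.det_fin_two_of]
      push_cast
      linear_combination (x 2 : ℂ) ^ 2 * Complex.I_sq
    rw [e, Complex.zero_le_real] at hd
    have h0' : 0 ≤ x 0 + x 3 := by simpa [Complex.le_def] using h0
    have h1' : 0 ≤ x 0 - x 3 := by simpa [Complex.le_def] using h1
    exact ⟨by linarith, by linarith⟩
  · rintro ⟨h0, h1⟩
    refine .of_dotProduct_mulVec_nonneg (isHermitian_blochOp x) fun v => ?_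
    obtain ⟨p, q, hv0⟩ : ∃ p q : ℝ, v 0 = ⟨p, q⟩ := ⟨_, _, rfl⟩
    obtain ⟨r, s, hv1⟩ : ∃ r s : ℝ, v 1 = ⟨r, s⟩ := ⟨_, _, rfl⟩
    have e : star v ⬝ᵥ (blochOp x *ᵥ v) = (((x 0 + x 3) * (p ^ 2 + q ^ 2) +
        (x 0 - x 3) * (r ^ 2 + s ^ 2) + 2 * (x 1 * (p * r + q * s) + x 2 * (p * s - q * r)) : ℝ) :
        ℂ) := by
      rw [blochOp_eq]
      simp only [dotProduct, Matrix.mulVec, Fin.sum_univ_two, Pi.star_apply, hv0, hv1]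
      apply Complex.ext <;> simp [pow_two] <;> ring
    rw [e, Complex.zero_le_real]
    have hx3 : |x 3| ≤ x 0 := abs_le_of_sq_le_sq (by nlinarith [sq_nonneg (x 1), sq_nonneg (x 2)]) h0
    obtain ⟨ha, hb⟩ := abs_le.1 hx3
    have ha : 0 ≤ x 0 + x 3 := by linarith
    rcases ha.eq_or_lt with ha | ha
    · have h12 : x 1 ^ 2 + x 2 ^ 2 = 0 := by
        have : x 0 = - x 3 := by linarith
        rw [this] at h1
        nlinarith [sq_nonneg (x 1), sq_nonneg (x 2)]
      have h1 : x 1 = 0 := by nlinarith [sq_nonneg (x 1), sq_nonneg (x 2)]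
      have h2 : x 2 = 0 := by nlinarith [sq_nonneg (x 1), sq_nonneg (x 2)]
      rw [← ha, h1, h2]
      have : 0 ≤ (x 0 - x 3) * (r ^ 2 + s ^ 2) := mul_nonneg (by linarith) (by positivity)
      linarith
    · -- Completing the square in the first component of `v`.
      refine nonneg_of_mul_nonneg_right (?_ : 0 ≤ (x 0 + x 3) * _) ha
      have : 0 ≤ (x 0 ^ 2 - (x 1 ^ 2 + x 2 ^ 2 + x 3 ^ 2)) * (r ^ 2 + s ^ 2) :=
        mul_nonneg (by linarith) (by positivity)
      linear_combination sq_nonneg ((x 0 + x 3) * p + x 1 * r + x 2 * s) +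
        sq_nonneg ((x 0 + x 3) * q + x 1 * s - x 2 * r) + this

/-- The superoperator that is diagonal in the Pauli basis, with the real eigenvalues `v`. -/
noncomputable def pauliDiagonal (v : Fin 4 → ℝ) : SuperOp :=
  ∑ α, (v α : ℂ) • (coeff α).smulRight (pauli α)

theorem coeff_pauliDiagonal (v : Fin 4 → ℝ) (β : Fin 4) (ω : Op) :
    coeff β (pauliDiagonal v ω) = v β * coeff β ω := by
  simp [pauliDiagonal, LinearMap.sum_apply, coeff_pauli]

theorem isTracePreserving_pauliDiagonal {v : Fin 4 → ℝ} (h0 : v 0 = 1) :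
    IsTracePreserving (pauliDiagonal v) := fun ω => by
  rw [trace_eq_coeff, trace_eq_coeff, coeff_pauliDiagonal, h0, Complex.ofReal_one, one_mul]

theorem pauliDiagonal_blochOp (v x : Fin 4 → ℝ) :
    pauliDiagonal v (blochOp x) = blochOp fun α => v α * x α := by
  refine op_ext fun β => ?_
  rw [coeff_pauliDiagonal]
  simp [blochOp, coeff_pauli]

/-- A diagonal map that fixes the trace and contracts the Bloch ball is positive. -/
theorem isPositiveMap_pauliDiagonal {v : Fin 4 → ℝ} (h0 : v 0 = 1) (h : ∀ α, v α ^ 2 ≤ 1) :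
    IsPositiveMap (pauliDiagonal v) := by
  intro ω hω
  obtain ⟨x, rfl⟩ : ∃ x, ω = blochOp x := ⟨_, eq_blochOp_of_isHermitian hω.1⟩
  rw [pauliDiagonal_blochOp, posSemidef_blochOp_iff] at *
  simp only [h0, one_mul, mul_pow]
  refine ⟨hω.1, le_trans ?_ hω.2⟩
  gcongr <;> exact mul_le_of_le_one_left (sq_nonneg _) (h _)

/-- The eigenvalues of a positive unital map on the Pauli matrices are at most `1` in modulus, since
the image `1 + v σ_k` of the rank one operator `1 + σ_k` has to be positive. -/
theorem sq_le_one_of_isPositiveMap {V : SuperOp} (hV : IsPositiveMap V)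
    (h1 : V (pauli 0) = pauli 0) {k : Fin 4} {v : ℝ} (hv : V (pauli k) = (v : ℂ) • pauli k) :
    v ^ 2 ≤ 1 := by
  by_cases hk : k = 0
  · subst hk
    rw [h1] at hv
    have := congrArg (coeff 0) hv
    simp only [map_smul, coeff_pauli, if_true, smul_eq_mul, mul_one] at this
    norm_cast at this
    simp [← this]
  have e : ∀ w : ℝ, pauli 0 + (w : ℂ) • pauli k = blochOp fun α =>
      if α = 0 then 1 else if α = k then w else 0 := by
    intro w
    refine op_ext fun β => ?_
    simp only [blochOp, map_add, map_sum, map_smul, coeff_pauli, smul_eq_mul, mul_ite, mul_one,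
      mul_zero, Finset.sum_ite_eq, Finset.mem_univ, if_true]
    by_cases hβ : β = 0
    · subst hβ; simp [Ne.symm hk]
    · by_cases hβ' : β = k <;> simp [hβ, hβ', hk]
  have hp : (pauli 0 + ((1 : ℝ) : ℂ) • pauli k).PosSemidef := by
    rw [e, posSemidef_blochOp_iff]
    fin_cases k <;> simp at hk ⊢
  have := hV _ hp
  rw [map_add, map_smul, h1, hv, Complex.ofReal_one, one_smul, e, posSemidef_blochOp_iff] at this
  fin_cases k
  · exact absurd rfl hk
  all_goals simpa using this.2

/-! ### Dynamics that are diagonal in the Pauli basis -/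

theorem intervalIntegrable_coeff {X : ℝ → Op} {a b : ℝ}
    (hX : ∀ i j, IntervalIntegrable (fun s => X s i j) volume a b) (β : Fin 4) :
    IntervalIntegrable (fun s => coeff β (X s)) volume a b := by
  simp only [coeff_eq_sum, Fin.sum_univ_two]
  exact (((hX 0 0).const_mul _).add ((hX 0 1).const_mul _)).add
    (((hX 1 0).const_mul _).add ((hX 1 1).const_mul _))

/-- A coefficient may be taken under the integral of an entrywise integral equation. -/
theorem coeff_eq_add_integral {X : ℝ → Op} {Y Z : Op} {a b : ℝ}
    (hX : ∀ i j, IntervalIntegrable (fun s => X s i j) volume a b)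
    (h : ∀ i j, Y i j = Z i j + ∫ s in a..b, X s i j) (β : Fin 4) :
    coeff β Y = coeff β Z + ∫ s in a..b, coeff β (X s) := by
  simp only [coeff_eq_sum, Fin.sum_univ_two, h]
  have i := fun i j => (hX i j).const_mul (1 / 2 * star (pauli β i j))
  rw [intervalIntegral.integral_add ((i 0 0).add (i 0 1)) ((i 1 0).add (i 1 1)),
    intervalIntegral.integral_add (i 0 0) (i 0 1), intervalIntegral.integral_add (i 1 0) (i 1 1)]
  simp only [intervalIntegral.integral_const_mul]
  ring

theorem intervalIntegrable_apply {K : ℝ → SuperOp} {X : ℝ → Op} {t : ℝ} (ht : 0 ≤ t)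
    (hK : LocInt K) (hX : ∀ i j, ContinuousOn (fun s => X s i j) (Ici 0)) (i j : Fin 2) :
    IntervalIntegrable (fun s => K s (X s) i j) volume 0 t := by
  simp only [superOp_apply_entry (K _) (X _)]
  refine intervalIntegrable_sum fun p => intervalIntegrable_sum fun q => ?_
  refine (hK (Matrix.single p q 1) i j t ht).mul_continuousOn ((hX p q).mono ?_)
  rw [uIcc_of_le ht]
  exact Icc_subset_Ici_self

theorem continuousOn_coeff {X : ℝ → Op} {s : Set ℝ}
    (hX : ∀ i j, ContinuousOn (fun t => X t i j) s) (β : Fin 4) :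
    ContinuousOn (fun t => coeff β (X t)) s := by
  simp only [coeff_eq_sum]
  exact continuousOn_finsetSum _ fun i _ => continuousOn_finsetSum _ fun j _ =>
    continuousOn_const.mul (hX i j)

/-- The superoperators `K_t` are diagonal in the Pauli basis with the real eigenvalues `r_α(t)`, for
almost every `t > 0`. -/
def IsPauliDiagonal (K : ℝ → SuperOp) (r : Fin 4 → ℝ → ℝ) : Prop :=
  ∀ᵐ t : ℝ, 0 < t → ∀ α β, coeff β (K t (pauli α)) = if β = α then (r β t : ℂ) else 0

theorem IsPauliDiagonal.intervalIntegrable {K : ℝ → SuperOp} {r : Fin 4 → ℝ → ℝ} (hK : LocInt K)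
    (hr : IsPauliDiagonal K r) (α : Fin 4) {t : ℝ} (ht : 0 ≤ t) :
    IntervalIntegrable (r α) volume 0 t := by
  have h := intervalIntegrable_coeff (fun i j => hK (pauli α) i j t ht) α
  have h' : IntervalIntegrable (fun s => (coeff α (K s (pauli α))).re) volume 0 t :=
    ⟨h.1.re, h.2.re⟩
  refine h'.congr_ae ?_
  rw [uIoc_of_le ht]
  filter_upwards [ae_restrict_Ioc_of_ae_pos hr le_rfl t] with s hs
  rw [hs α α, if_pos rfl, Complex.ofReal_re]

theorem coeff_evolution_eq_integral {K Λ : ℝ → SuperOp} {r : Fin 4 → ℝ → ℝ}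
    (h : IsTimeLocalEvolution K Λ) (hr : IsPauliDiagonal K r) (β : Fin 4) (ω : Op) {t : ℝ}
    (ht : 0 ≤ t) :
    coeff β (Λ t ω) = coeff β ω + ∫ s in (0 : ℝ)..t, (r β s : ℂ) * coeff β (Λ s ω) := by
  rw [coeff_eq_add_integral (intervalIntegrable_apply ht h.locInt (h.continuousOn ω))
    (fun i j => h.eq_integral ω i j t ht)]
  congr 1
  rw [intervalIntegral.integral_of_le ht, intervalIntegral.integral_of_le ht]
  refine integral_congr_ae ?_
  filter_upwards [ae_restrict_Ioc_of_ae_pos hr le_rfl t] with s hs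
  exact coeff_apply_of_diagonal (μ := fun β => (r β s : ℂ)) hs β _

/-- Dynamics with a generator that is diagonal in the Pauli basis are diagonal, too, with the
eigenvalues `exp (∫ r_β)`. -/
theorem coeff_evolution {K Λ : ℝ → SuperOp} {r : Fin 4 → ℝ → ℝ}
    (h : IsTimeLocalEvolution K Λ) (hr : IsPauliDiagonal K r) (β : Fin 4) (ω : Op) {t : ℝ}
    (ht : 0 ≤ t) :
    coeff β (Λ t ω) = coeff β ω * (Real.exp (∫ s in (0 : ℝ)..t, r β s) : ℂ) :=
  eq_mul_exp_of_eq_integral_complex (y := fun t => coeff β (Λ t ω)) ht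
    (hr.intervalIntegrable h.locInt β ht)
    ((continuousOn_coeff (h.continuousOn ω) β).mono Icc_subset_Ici_self)
    fun _ hs => coeff_evolution_eq_integral h hr β ω hs.1

/-- Trace-preserving Pauli-diagonal dynamics are P-divisible if and only if their (positive)
eigenvalues decrease. -/
theorem pDivisible_iff_antitoneOn {Λ : ℝ → SuperOp} {R : Fin 4 → ℝ → ℝ}
    (h : ∀ (β : Fin 4) (ω : Op) (t : ℝ), 0 ≤ t →
      coeff β (Λ t ω) = coeff β ω * (Real.exp (R β t) : ℂ))
    (h0 : ∀ t, 0 ≤ t → R 0 t = 0) : PDivisible Λ ↔ ∀ β, AntitoneOn (R β) (Ici 0) := by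
  have hΛ : ∀ α t, 0 ≤ t → Λ t (pauli α) = (Real.exp (R α t) : ℂ) • pauli α := fun α t ht => by
    refine op_ext fun β => ?_
    rw [h β _ t ht, map_smul, coeff_pauli]
    by_cases hβ : β = α <;> simp [hβ]
  constructor
  · intro hdiv β s hs t ht hst
    obtain ⟨V, hV, -, hVt⟩ := hdiv s t hs hst
    have hVα : ∀ α, V (pauli α) = (Real.exp (R α t - R α s) : ℂ) • pauli α := fun α => by
      have e := LinearMap.congr_fun hVt (pauli α)
      rw [LinearMap.comp_apply, hΛ α s hs, hΛ α t ht, map_smul] at e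
      have ne : (Real.exp (R α s) : ℂ) ≠ 0 := by exact_mod_cast (Real.exp_pos _).ne'
      rw [← smul_right_inj ne, ← e, smul_smul, ← Complex.ofReal_mul, ← Real.exp_add,
        add_sub_cancel]
    have h1 : V (pauli 0) = pauli 0 := by
      rw [hVα, h0 s hs, h0 t ht, sub_self, Real.exp_zero, Complex.ofReal_one, one_smul]
    have h2 := (sq_le_one_iff₀ (Real.exp_pos _).le).1 (sq_le_one_of_isPositiveMap hV h1 (hVα β))
    rw [Real.exp_le_one_iff] at h2
    linarith
  · intro hR s t hs hst
    have ht := hs.trans hst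
    refine ⟨pauliDiagonal fun α => Real.exp (R α t - R α s), isPositiveMap_pauliDiagonal ?_ ?_,
      isTracePreserving_pauliDiagonal ?_, ?_⟩
    · simp [h0 s hs, h0 t ht]
    · intro α
      rw [sq_le_one_iff₀ (Real.exp_pos _).le, Real.exp_le_one_iff]
      linarith [hR α hs ht hst]
    · simp [h0 s hs, h0 t ht]
    · refine LinearMap.ext fun ω => op_ext fun β => ?_
      rw [LinearMap.comp_apply, coeff_pauliDiagonal, h β ω t ht, h β ω s hs, mul_left_comm,
        ← Complex.ofReal_mul, ← Real.exp_add, sub_add_cancel]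

/-! ### The Redfield-like generator of Pauli dynamics -/

/-- The eigenvalue of the Pauli generator belonging to `σ_α`, as a real number. -/
noncomputable def pauliRate (γ : Fin 3 → ℝ → ℝ) (α : Fin 4) (t : ℝ) : ℝ :=
  (eigenvalue (pauliGenerator γ t) α).re

theorem eigenvalue_pauliGenerator (γ : Fin 3 → ℝ → ℝ) (t : ℝ) (α : Fin 4) :
    eigenvalue (pauliGenerator γ t) α = pauliRate γ α t := by
  apply Complex.ext
  · rfl
  · rw [Complex.ofReal_im, eigenvalue_eq_coeff, pauliGenerator_apply, coeff_eq_sum]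
    fin_cases α <;>
      simp [pauli, Fin.sum_univ_three, Fin.sum_univ_two]

theorem pauliRate_zero (γ : Fin 3 → ℝ → ℝ) (t : ℝ) : pauliRate γ 0 t = 0 := by
  rw [pauliRate, eigenvalue_eq_coeff, pauliGenerator_apply, coeff_eq_sum]
  simp [pauli, Fin.sum_univ_three, Fin.sum_univ_two]

theorem isPauliDiagonal_pauliGenerator (γ : Fin 3 → ℝ → ℝ) :
    IsPauliDiagonal (pauliGenerator γ) (pauliRate γ) :=
  Filter.Eventually.of_forall fun t _ α β => by
    rw [pauliGenerator_pauli, eigenvalue_pauliGenerator, map_smul, coeff_pauli]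
    by_cases h : β = α <;> simp [h]

/-- If the eigenvalue `λ = exp (∫ r_α)` of Pauli-diagonal dynamics decreases, the matrix elements
`k = Tr[σ_βᴴ K_t(σ_α)] / 2` of the Redfield-like generator satisfy `Re (u k) ≤ 0` almost everywhere,
provided that the right-hand side `Re (u δ_{αβ}) (λ - 1)` of the convolution equation for `Re (u k)`
is `c (λ - 1)` with `c ≥ 0`. -/
theorem ae_redfield_le {K Λ KRed : ℝ → SuperOp} {r : Fin 4 → ℝ → ℝ}
    (hΛ : IsTimeLocalEvolution K Λ) (hr : IsPauliDiagonal K r) (hK : IsRedfieldGenerator Λ KRed)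
    {α : Fin 4} (hanti : AntitoneOn (fun t => ∫ s in (0 : ℝ)..t, r α s) (Ici 0))
    {β : Fin 4} {u : ℂ} {c : ℝ} (hc : 0 ≤ c)
    (hu : ∀ t, 0 ≤ t → (u * coeff β (pauli α)).re * (Real.exp (∫ s in (0 : ℝ)..t, r α s) - 1) =
      c * (Real.exp (∫ s in (0 : ℝ)..t, r α s) - 1)) :
    ∀ᵐ t, 0 < t → (u * coeff β (KRed t (pauli α))).re ≤ 0 := by
  set lam : ℝ → ℝ := fun t => Real.exp (∫ s in (0 : ℝ)..t, r α s) with hlam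
  have clam : ContinuousOn lam (Ici 0) := by
    have h := continuousOn_coeff (hΛ.continuousOn (pauli α)) α
    refine (Complex.continuous_re.comp_continuousOn h).congr fun t ht => ?_
    simp only [Function.comp, coeff_evolution hΛ hr α (pauli α) ht, coeff_pauli, if_true, one_mul,
      Complex.ofReal_re, hlam]
  have lam_int : ∀ t, 0 ≤ t → lam t = 1 + ∫ s in (0 : ℝ)..t, r α s * lam s := by
    intro t ht
    have h := coeff_evolution_eq_integral hΛ hr α (pauli α) ht
    rw [coeff_evolution hΛ hr α (pauli α) ht, coeff_pauli, if_pos rfl, one_mul] at h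
    have e : ∫ s in (0 : ℝ)..t, (r α s : ℂ) * coeff α (Λ s (pauli α)) =
        ∫ s in (0 : ℝ)..t, ((r α s * lam s : ℝ) : ℂ) := by
      refine intervalIntegral.integral_congr fun s hs => ?_
      rw [uIcc_of_le ht] at hs
      simp [coeff_evolution hΛ hr α (pauli α) hs.1, coeff_pauli, hlam]
    rw [e, intervalIntegral.integral_ofReal] at h
    exact_mod_cast h
  have ig : ∀ t, 0 ≤ t → IntervalIntegrable (fun s => -(r α s * lam s)) volume 0 t :=
    fun t ht => ((hr.intervalIntegrable hΛ.locInt α ht).mul_continuousOn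
      (clam.mono (by rw [uIcc_of_le ht]; exact Icc_subset_Ici_self))).neg
  have ik : ∀ t, 0 ≤ t → IntervalIntegrable (fun s => coeff β (KRed s (pauli α))) volume 0 t :=
    fun t ht => intervalIntegrable_coeff (fun i j => hK.locInt (pauli α) i j t ht) β
  have eqg : ∀ t, 0 ≤ t → lam t = 1 - ∫ s in (0 : ℝ)..t, -(r α s * lam s) := by
    intro t ht
    rw [intervalIntegral.integral_neg, sub_neg_eq_add, ← lam_int t ht]
  -- The equation for `λ` itself shows that `λ = 1 - ∫ g` with `g = -r_α λ`.
  refine ae_nonpos_of_convolution_eq (g := fun s => -(r α s * lam s)) (lam := lam) hc ig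
    (fun t ht => ⟨((ik t ht).1.const_mul u).re, ((ik t ht).2.const_mul u).re⟩) ?_ eqg ?_
  · refine ae_nonneg_of_monotoneOn_primitive ig fun s hs t ht hst => ?_
    have h : lam t ≤ lam s := Real.exp_le_exp.2 (hanti hs ht hst)
    rw [eqg t ht, eqg s hs] at h
    simp only
    linarith
  · intro t ht
    have hΛα : ∀ s, 0 ≤ s → Λ s (pauli α) = (lam s : ℂ) • pauli α := fun s hs => by
      refine op_ext fun β => ?_
      rw [coeff_evolution hΛ hr β _ hs, map_smul, coeff_pauli]
      by_cases hβ : β = α <;> simp [hβ, hlam]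
    have clam' : ContinuousOn (fun s => (lam s : ℂ)) (uIcc 0 t) :=
      Complex.continuous_ofReal.comp_continuousOn
        (clam.mono (by rw [uIcc_of_le ht]; exact Icc_subset_Ici_self))
    have iX : ∀ i j, IntervalIntegrable
        (fun s => ((lam s : ℂ) • KRed (t - s) (pauli α)) i j) volume 0 t := by
      intro i j
      have h := (hK.locInt (pauli α) i j t ht).comp_sub_left t
      rw [sub_zero, sub_self] at h
      exact h.symm.continuousOn_mul clam'
    have eX : ∀ i j, ((lam t : ℂ) • pauli α) i j = pauli α i j +
        ∫ s in (0 : ℝ)..t, ((lam s : ℂ) • KRed (t - s) (pauli α)) i j := by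
      intro i j
      rw [← hΛα t ht, hK.eq_convolution (pauli α) i j t ht]
      congr 1
      refine intervalIntegral.integral_congr fun s hs => ?_
      rw [uIcc_of_le ht] at hs
      simp only [hΛα s hs.1, map_smul]
    have h := congrArg (fun z => (u * z).re) (coeff_eq_add_integral iX eX β)
    have iu := (intervalIntegrable_coeff iX β).const_mul u
    have hre := Complex.reCLM.intervalIntegral_comp_comm iu
    simp only [map_smul, smul_eq_mul] at h hre
    rw [mul_add, Complex.add_re, ← intervalIntegral.integral_const_mul] at h
    simp only [Complex.reCLM_apply] at hre
    rw [← hre, mul_left_comm, Complex.re_ofReal_mul] at h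
    simp only [mul_left_comm u, Complex.re_ofReal_mul] at h
    rw [← hu t ht]
    simp only [mul_comm _ (lam _)] at h ⊢
    linarith

/-- The Redfield-like generator of trace-preserving Pauli-diagonal dynamics with decreasing
eigenvalues is almost everywhere diagonal, with nonpositive eigenvalues. -/
theorem isPauliDiagonal_redfield {K Λ KRed : ℝ → SuperOp} {r : Fin 4 → ℝ → ℝ}
    (hΛ : IsTimeLocalEvolution K Λ) (hr : IsPauliDiagonal K r) (hr0 : ∀ t, r 0 t = 0)
    (hK : IsRedfieldGenerator Λ KRed)
    (hanti : ∀ α, AntitoneOn (fun t => ∫ s in (0 : ℝ)..t, r α s) (Ici 0)) :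
    ∃ q : Fin 4 → ℝ → ℝ, IsPauliDiagonal KRed q ∧ (∀ t, q 0 t = 0) ∧
      ∀ α, ∀ᵐ t, 0 < t → q α t ≤ 0 := by
  have key := fun α β u c => ae_redfield_le hΛ hr hK (hanti α) (β := β) (u := u) (c := c)
  -- The imaginary parts have a vanishing right-hand side, and so have the real parts unless
  -- `α = β ≠ 0`; in these cases both signs of `u` are admissible.
  have im : ∀ α β, ∀ᵐ t, 0 < t → (coeff β (KRed t (pauli α))).im = 0 := by
    intro α β
    have h1 := key α β Complex.I 0 le_rfl (by
      intro t _; rw [coeff_pauli]; split_ifs <;> simp)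
    have h2 := key α β (-Complex.I) 0 le_rfl (by
      intro t _; rw [coeff_pauli]; split_ifs <;> simp)
    filter_upwards [h1, h2] with t h1 h2 ht
    have h1 := h1 ht
    have h2 := h2 ht
    simp at h1 h2
    linarith
  have re : ∀ α β, β ≠ α ∨ α = 0 → ∀ᵐ t, 0 < t → (coeff β (KRed t (pauli α))).re = 0 := by
    intro α β hαβ
    have h1 := key α β 1 0 le_rfl (by
      intro t _; rcases hαβ with h | h <;> simp [coeff_pauli, h, hr0])
    have h2 := key α β (-1) 0 le_rfl (by
      intro t _; rcases hαβ with h | h <;> simp [coeff_pauli, h, hr0])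
    filter_upwards [h1, h2] with t h1 h2 ht
    have h1 := h1 ht
    have h2 := h2 ht
    simp at h1 h2
    linarith
  refine ⟨fun α t => if α = 0 then 0 else (coeff α (KRed t (pauli α))).re, ?_,
    fun t => if_pos rfl, fun α => ?_⟩
  · have h1 := ae_all_iff.2 fun α => ae_all_iff.2 (im α)
    have h2 := ae_all_iff.2 fun α => ae_all_iff.2 fun β => ae_all_iff.2 (re α β)
    filter_upwards [h1, h2] with t h1 h2 ht α β
    apply Complex.ext
    · by_cases h : β = α
      · subst h
        by_cases h0 : β = 0
        · simpa [h0] using h2 0 0 (Or.inr rfl) ht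
        · simp [h0]
      · simpa [h] using h2 α β (Or.inl h) ht
    · rw [h1 α β ht]
      split_ifs <;> simp
  · have h := key α α 1 1 zero_le_one (by intro t _; simp [coeff_pauli])
    filter_upwards [h] with t h ht
    split_ifs
    · exact le_rfl
    · simpa using h ht

/-- P-divisibility passes from trace-preserving Pauli-diagonal dynamics to the associated
Redfield-like dynamics. -/
theorem PDivisible.redfield {K Λ KRed ΛRed : ℝ → SuperOp} {r : Fin 4 → ℝ → ℝ}
    (hΛ : IsTimeLocalEvolution K Λ) (hr : IsPauliDiagonal K r) (hr0 : ∀ t, r 0 t = 0)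
    (hdiv : PDivisible Λ) (hK : IsRedfieldGenerator Λ KRed)
    (hΛRed : IsTimeLocalEvolution KRed ΛRed) : PDivisible ΛRed := by
  have hanti := (pDivisible_iff_antitoneOn (R := fun α t => ∫ s in (0 : ℝ)..t, r α s)
    (fun β ω t ht => coeff_evolution hΛ hr β ω ht) fun t _ => by simp [hr0]).1 hdiv
  obtain ⟨q, hq, hq0, hqle⟩ := isPauliDiagonal_redfield hΛ hr hr0 hK hanti
  refine (pDivisible_iff_antitoneOn (R := fun α t => ∫ s in (0 : ℝ)..t, q α s)
    (fun β ω t ht => coeff_evolution hΛRed hq β ω ht) fun t _ => by simp [hq0]).2 fun α => ?_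
  have hmono := monotoneOn_primitive_of_ae_nonneg (g := fun s => -q α s)
    (fun t ht => (hq.intervalIntegrable hΛRed.locInt α ht).neg)
    (by filter_upwards [hqle α] with t h ht using neg_nonneg.2 (h ht))
  intro s hs t ht hst
  have := hmono hs ht hst
  simp only [intervalIntegral.integral_neg] at this
  exact neg_le_neg_iff.1 this

end PauliDynamics

theorem corollary3 (γ : Fin 3 → ℝ → ℝ)
    (Λ KRed ΛRed : ℝ → PauliDynamics.SuperOp)
    (hΛ : PauliDynamics.IsTimeLocalEvolution (PauliDynamics.pauliGenerator γ) Λ)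
    (hG : PauliDynamics.LaplaceCondition (PauliDynamics.pauliGenerator γ))
    (hdiv : PauliDynamics.PDivisible Λ)
    (hK : PauliDynamics.IsRedfieldGenerator Λ KRed)
    (hΛRed : PauliDynamics.IsTimeLocalEvolution KRed ΛRed) :
    PauliDynamics.PDivisible ΛRed :=
  PauliDynamics.PDivisible.redfield hΛ (PauliDynamics.isPauliDiagonal_pauliGenerator γ)
    (PauliDynamics.pauliRate_zero γ) hdiv hK hΛRed
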